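/- Let $\mathbb{S}^n$ be the space of complex symmetric $n\times n$ matrices, with coordinates $x_{ij}$ ($1\le i\le j\le n$). Let $\mathcal{L}\subset\mathbb{S}^n$ be a regular pencil, that is, a two-dimensional linear subspace on which the determinant does not vanish identically. Let $\sigma=[\sigma_1,\dots,\sigma_r]$ be its Segre symbol: choose a basis $\{A,B\}$ of $\mathcal{L}$ with $B$ invertible; each of the $r$ distinct eigenvalues of $AB^{-1}$ contributes the partition $\sigma_i=(\sigma_{i1}\ge\sigma_{i2}\ge\cdots)$ of the sizes of the Jordan blocks of $AB^{-1}$ with that eigenvalue. Let the reciprocal curve $\mathbb{P}\mathcal{L}^{-1}\subset\mathbb{P}(\mathbb{S}^n)$ be the Zariski closure of the set of points given by the inverses of all invertible matrices in $\mathcal{L}$. Put $d=\sum_{i=1}^r\sigma_{i1}-1$. Then $\mathbb{P}\mathcal{L}^{-1}$ is a rational normal curve of degree $d\ge 1$, i.e. the image of $\{(s^d:s^{d-1}t:\cdots:t^d)\}\subset\mathbb{P}^d$ under a linear embedding $\mathbb{P}^d\hookrightarrow\mathbb{P}(\mathbb{S}^n)$. Its homogeneous vanishing ideal in $\mathbb{C}[x_{ij}]$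 is prime. Moreover $d+1\le\binom{n+1}{2}$, and there are linear forms $\ell_1,\dots,\ell_{\binom{n+1}{2}-d-1}$ and $u_0,\dots,u_d$ in the $\binom{n+1}{2}$ unknowns $x_{ij}$, together linearly independent, such that the ideal is generated by $\ell_1,\dots,\ell_{\binom{n+1}{2}-d-1}$ and the $\binom{d}{2}$ quadrics given by the $2\times 2$ minors of the Hankel matrix $$\begin{pmatrix} u_0&u_1&\cdots&u_{d-1}\\ u_1&u_2&\cdots&u_d\end{pmatrix};$$ these $\binom{d}{2}$ minors are distinct and linearly independent. -/

import Mathlib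

open scoped LinearAlgebra.Projectivization

/-- The space `𝕊ⁿ` of complex symmetric `n × n` matrices. -/
def symMatrices (n : ℕ) : Submodule ℂ (Matrix (Fin n) (Fin n) ℂ) where
  carrier := {X | X.IsSymm}
  add_mem' hX hY := Matrix.IsSymm.add hX hY
  zero_mem' := Matrix.isSymm_zero
  smul_mem' c _ hX := Matrix.IsSymm.smul hX c

/-- The matrix underlying an element of `𝕊ⁿ`. -/
abbrev toMat {n : ℕ} (X : symMatrices n) : Matrix (Fin n) (Fin n) ℂ := X.1

/-- A pencil of quadrics: a two-dimensional linear subspace of `𝕊ⁿ`. -/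
def IsPencil {n : ℕ} (L : Submodule ℂ (symMatrices n)) : Prop :=
  Module.finrank ℂ L = 2

/-- A pencil is regular if the determinant does not vanish identically on it. -/
def IsRegularPencil {n : ℕ} (L : Submodule ℂ (symMatrices n)) : Prop :=
  IsPencil L ∧ ∃ X ∈ L, (toMat X).det ≠ 0

/-! ### Segre symbols -/

/-- The `e × e` upper triangular Jordan block with eigenvalue `α`. -/
def jordanBlock (e : ℕ) (α : ℂ) : Matrix (Fin e) (Fin e) ℂ :=
  Matrix.of fun i j => if i = j then α else if (i : ℕ) + 1 = (j : ℕ) then 1 else 0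

/-- The Jordan canonical form of `M` consists of the `s` (nonempty) Jordan blocks of sizes `e k`
and eigenvalues `α k`: `M` is similar to the block diagonal matrix with these blocks. -/
def HasJordanForm {n : ℕ} (M : Matrix (Fin n) (Fin n) ℂ) {s : ℕ}
    (α : Fin s → ℂ) (e : Fin s → ℕ) : Prop :=
  (∀ k, 0 < e k) ∧
  ∃ (f : (Σ k : Fin s, Fin (e k)) ≃ Fin n) (P : Matrix (Fin n) (Fin n) ℂ), P.det ≠ 0 ∧
    M = P * Matrix.reindex f f (Matrix.blockDiagonal' fun k => jordanBlock (e k) (α k)) * P⁻¹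

/-- The multiset of partitions recorded by a list of Jordan blocks: one partition for every
distinct eigenvalue, its parts being the sizes of the blocks with that eigenvalue. -/
noncomputable def blockPartitions {s : ℕ} (α : Fin s → ℂ) (e : Fin s → ℕ) :
    Multiset (Multiset ℕ) :=
  (Finset.univ.image α).val.map fun a => (Finset.univ.filter fun k => α k = a).val.map e

/-- `σ` (a multiset of partitions, each written as the multiset of its positive parts) is the
Segre symbol of the pencil `L`: it is read off from the Jordan canonical form of `A * B⁻¹`
for a basis `A, B` of `L` with `B` invertible. -/
def IsSegreSymbol {n : ℕ} (L : Submodule ℂ (symMatrices n)) (σ : Multiset (Multiset ℕ)) : Prop :=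
  ∃ A B : symMatrices n, LinearIndependent ℂ ![A, B] ∧ Submodule.span ℂ {A, B} = L ∧
    (toMat B).det ≠ 0 ∧
    ∃ (s : ℕ) (α : Fin s → ℂ) (e : Fin s → ℕ),
      HasJordanForm (toMat A * (toMat B)⁻¹) α e ∧ σ = blockPartitions α e

/-- The sum `∑ᵢ σᵢ₁` of the first (that is, largest) parts of the partitions in `σ`. -/
def sumFirstParts (σ : Multiset (Multiset ℕ)) : ℕ :=
  (σ.map Multiset.sup).sum

/-! ### Projective geometry in `ℙ(𝕊ⁿ)` -/

/-- The index set of the `n(n+1)/2` unknowns `x_{ij}`, `i ≤ j`. -/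
abbrev SymIndex (n : ℕ) : Type := {p : Fin n × Fin n // p.1 ≤ p.2}

/-- The value of a polynomial in the unknowns `x_{ij}`, `i ≤ j`, at a symmetric matrix. -/
noncomputable def evalSym {n : ℕ} (X : symMatrices n) (f : MvPolynomial (SymIndex n) ℂ) : ℂ :=
  MvPolynomial.eval (fun p : SymIndex n => toMat X p.1.1 p.1.2) f

/-- The homogeneous vanishing ideal of a set of points of `ℙ(𝕊ⁿ)`: all polynomials that vanish
at every representative of every point of the set. -/
noncomputable def vanishingIdealProj {n : ℕ} (S : Set (ℙ ℂ (symMatrices n))) :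
    Ideal (MvPolynomial (SymIndex n) ℂ) where
  carrier := {f | ∀ (X : symMatrices n) (hX : X ≠ 0), Projectivization.mk ℂ X hX ∈ S →
    evalSym X f = 0}
  add_mem' hf hg X hX hS := by
    have h1 := hf X hX hS
    have h2 := hg X hX hS
    simp only [evalSym] at h1 h2 ⊢
    rw [map_add, h1, h2, add_zero]
  zero_mem' X hX hS := by simp [evalSym]
  smul_mem' c f hf X hX hS := by
    have h1 := hf X hX hS
    simp only [evalSym] at h1 ⊢
    rw [smul_eq_mul, map_mul, h1, mul_zero]

/-- The Zariski closure of a set of points of `ℙ(𝕊ⁿ)`. -/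
def zariskiClosure {n : ℕ} (S : Set (ℙ ℂ (symMatrices n))) : Set (ℙ ℂ (symMatrices n)) :=
  {p | ∀ f ∈ vanishingIdealProj S, ∀ (X : symMatrices n) (hX : X ≠ 0),
    Projectivization.mk ℂ X hX = p → evalSym X f = 0}

/-- The set of the inverses of all invertible matrices in `L`. -/
def inverseSet {n : ℕ} (L : Submodule ℂ (symMatrices n)) : Set (symMatrices n) :=
  {Y | ∃ X ∈ L, toMat X * toMat Y = 1}

/-- The reciprocal curve `ℙL⁻¹`: the Zariski closure in `ℙ(𝕊ⁿ)` of the points given by the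
inverses of the invertible matrices in `L`. -/
def reciprocalCurve {n : ℕ} (L : Submodule ℂ (symMatrices n)) : Set (ℙ ℂ (symMatrices n)) :=
  zariskiClosure {p | ∃ Y ∈ inverseSet L, ∃ hY : Y ≠ 0, p = Projectivization.mk ℂ Y hY}

/-- The standard rational normal curve of degree `d` in `ℙ^d`: the image of `ℙ¹` under
`(s : t) ↦ (s^d : s^(d-1) t : ⋯ : t^d)`. -/
def standardRationalNormalCurve (d : ℕ) : Set (ℙ ℂ (Fin (d + 1) → ℂ)) :=
  {p | ∃ s t : ℂ, (s ≠ 0 ∨ t ≠ 0) ∧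
    ∃ h : (fun i : Fin (d + 1) => s ^ (d - (i : ℕ)) * t ^ (i : ℕ)) ≠ 0,
      p = Projectivization.mk ℂ _ h}

/-- A rational normal curve of degree `d ≥ 1` in a projective space `ℙ(V)`: the image of the
standard one under a linear embedding `ℙ^d → ℙ(V)`. -/
def IsRationalNormalCurve {V : Type*} [AddCommGroup V] [Module ℂ V] (d : ℕ)
    (C : Set (ℙ ℂ V)) : Prop :=
  1 ≤ d ∧ ∃ (φ : (Fin (d + 1) → ℂ) →ₗ[ℂ] V) (hφ : Function.Injective φ),
    C = Projectivization.map φ hφ '' standardRationalNormalCurve d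

/-! ### Hankel minors -/

/-- The `2 × d` Hankel matrix with rows `u₀, …, u_{d-1}` and `u₁, …, u_d`. -/
def hankelMatrix {R : Type*} {d : ℕ} (u : Fin (d + 1) → R) : Matrix (Fin 2) (Fin d) R :=
  Matrix.of ![fun j => u j.castSucc, fun j => u j.succ]

/-- The index set of the `2 × 2` minors of a matrix with `2` rows and `d` columns. -/
abbrev ColumnPairs (d : ℕ) : Type := {p : Fin d × Fin d // p.1 < p.2}

/-- The `2 × 2` minors of the `2 × d` Hankel matrix. -/
def hankelMinor {R : Type*} [CommRing R] {d : ℕ} (u : Fin (d + 1) → R) (p : ColumnPairs d) : R :=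
  ((hankelMatrix u).submatrix id ![p.1.1, p.1.2]).det

/-!
# Reciprocal curves of regular pencils are rational normal curves

Let `A, B` be a basis of the pencil with `B` invertible, put `M = A * B⁻¹`, and let `μ` be the
minimal polynomial of `M`.

*Degree.* A polynomial `q` annihilates a Jordan block of size `e` with eigenvalue `a` if and only
if `(X - a) ^ e` divides `q`. Hence `μ` is the product of the `(X - a) ^ m`, where `m` is the
largest size of a block with eigenvalue `a`, and the sum of the first parts of the Segre symbol is
`deg μ = d + 1` (`sumFirstParts_eq_natDegree_minpoly`). Since `A` and `B` are independent, `M` is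
not scalar, so `d ≥ 1`.

*Parametrization.* The quotient of `μ(T) - μ(M) = μ(T)` by `T - M` is a polynomial in `T` of degree
`d` whose `d + 1` coefficients `Q i` are polynomials in `M` of the distinct degrees `d, …, 0`, hence
linearly independent. Homogenized, this says that `t * B - s * A` times
`∑ i, s ^ (d - i) * t ^ i • B⁻¹ * Q i` is the homogenized `μ(s, t)` times the identity
(`pencil_mul_conePoint`), and the matrices `B⁻¹ * Q i` are symmetric. So the inverses of the
invertible members of the pencil are, up to scalars, the points of a rational normal curve in the
span of the `B⁻¹ * Q i` at which `μ(s, t) ≠ 0` (`mk_mem_inverse_points_iff`). A polynomial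
vanishing there vanishes on the whole curve, so the vanishing ideal is the kernel of a
homomorphism to `ℂ[s, t]` (`vanishingIdealProj_eq_ker`); in particular it is prime.

*Generators.* Extend the `B⁻¹ * Q i` to a basis of `𝕊ⁿ` and use dual coordinates. The coordinates
complementary to the span lie in the ideal, which reduces everything to the standard curve
(`exists_generators_ker_veroneseHom_comp_spanHom`). There, modulo the Hankel minors, a
product `u i * u j` depends only on `i + j`, so each monomial equals a normal form determined by
its degree and weight, that is, by its image in `ℂ[s, t]`; therefore the kernel is generated by the
minors (`aeval_eq_zero_of_veroneseHom_eq_zero`). The points at which all generators vanish are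
exactly those of the curve, so it is Zariski closed.
-/

/-! ### Numbers of unknowns and of minors -/

theorem card_symIndex (n : ℕ) : Fintype.card (SymIndex n) = (n + 1).choose 2 := by
  rw [← Fintype.card_congr (Sym2.sortEquiv (α := Fin n)), Sym2.card, Fintype.card_fin]

theorem card_columnPairs (d : ℕ) : Fintype.card (ColumnPairs d) = d.choose 2 := by
  have e : SymIndex d ≃ ColumnPairs d ⊕ Fin d :=
    { toFun := fun p => if h : p.1.1 < p.1.2 then Sum.inl ⟨p.1, h⟩ else Sum.inr p.1.1
      invFun := Sum.elim (fun p => ⟨p.1, p.2.le⟩) (fun i => ⟨(i, i), le_rfl⟩)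
      left_inv := by
        rintro ⟨⟨i, j⟩, h⟩
        by_cases h' : i < j
        · simp [h']
        · have : i = j := le_antisymm h (not_lt.mp h')
          simp [this]
      right_inv := by
        rintro (⟨⟨i, j⟩, h⟩ | i)
        · simp [show i < j from h]
        · simp }
  have h1 := Fintype.card_congr e
  rw [card_symIndex, Fintype.card_sum, Fintype.card_fin, Nat.choose_succ_succ' d 1,
    Nat.choose_one_right, add_comm] at h1
  exact (Nat.add_right_cancel h1).symm

/-! ### Hankel minors and normal forms of monomials -/

theorem hankelMinor_apply {R : Type*} [CommRing R] {d : ℕ} (u : Fin (d + 1) → R)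
    (p : ColumnPairs d) :
    hankelMinor u p = u p.1.1.castSucc * u p.1.2.succ - u p.1.2.castSucc * u p.1.1.succ := by
  simp [hankelMinor, hankelMatrix, Matrix.det_fin_two]

theorem map_hankelMinor {R S : Type*} [CommRing R] [CommRing S] (φ : R →+* S) {d : ℕ}
    (u : Fin (d + 1) → R) (p : ColumnPairs d) :
    φ (hankelMinor u p) = hankelMinor (fun i => φ (u i)) p := by
  simp [hankelMinor_apply]

/-- If all the minors of the Hankel matrix vanish, the product `u i * u j` depends on `i + j`
only. This is the exchange rule behind every reduction modulo the Hankel minors. -/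
theorem mul_eq_mul_of_hankelMinor_eq_zero {R : Type*} [CommRing R] {d : ℕ} {u : Fin (d + 1) → R}
    (hu : ∀ p, hankelMinor u p = 0) (i j i' j' : Fin (d + 1))
    (h : (i : ℕ) + j = (i' : ℕ) + j') : u i * u j = u i' * u j' := by
  have step : ∀ a b : Fin d, u a.castSucc * u b.succ = u b.castSucc * u a.succ := by
    intro a b
    rcases lt_trichotomy a b with hab | rfl | hab
    · have := hu ⟨(a, b), hab⟩
      rw [hankelMinor_apply] at this
      exact sub_eq_zero.mp this
    · rfl
    · have := hu ⟨(b, a), hab⟩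
      rw [hankelMinor_apply] at this
      exact (sub_eq_zero.mp this).symm
  have key : ∀ k : ℕ, ∀ i j i' j' : Fin (d + 1), (i : ℕ) + j = (i' : ℕ) + j' →
      (i' : ℕ) = i + k → u i * u j = u i' * u j' := by
    intro k
    induction k with
    | zero =>
      intro i j i' j' h hk
      have h1 : i' = i := Fin.ext (by omega)
      have h2 : j' = j := Fin.ext (by omega)
      rw [h1, h2]
    | succ k ih =>
      intro i j i' j' h hk
      have hi : (i : ℕ) < d := by omega
      have hj : (j : ℕ) - 1 < d := by omega
      have h1 := step ⟨i, hi⟩ ⟨j - 1, hj⟩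
      have e1 : (⟨i, hi⟩ : Fin d).castSucc = i := Fin.ext rfl
      have e2 : (⟨j - 1, hj⟩ : Fin d).succ = j := Fin.ext (by simp; omega)
      rw [e1, e2] at h1
      rw [h1, mul_comm]
      exact ih _ _ _ _ (by simp; omega) (by simp; omega)
  rcases le_total (i : ℕ) i' with hle | hle
  · exact key (i' - i) i j i' j' h (by omega)
  · exact (key (i - i') i' j' i j h.symm (by omega)).symm

/-- The greedy normal form of a monomial of degree `k` and weight `w` in `u 0, …, u d`
(where `u i` has weight `i`): the largest possible index is split off first. -/
def greedyMonomial {R : Type*} [CommRing R] {d : ℕ} (u : Fin (d + 1) → R) : ℕ → ℕ → R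
  | 0, _ => 1
  | k + 1, w => u ⟨min w d, by omega⟩ * greedyMonomial u k (w - min w d)

theorem mul_greedyMonomial {R : Type*} [CommRing R] {d : ℕ} {u : Fin (d + 1) → R}
    (hu : ∀ p, hankelMinor u p = 0) (k : ℕ) : ∀ (i : Fin (d + 1)) (w : ℕ), w ≤ d * k →
      u i * greedyMonomial u k w = greedyMonomial u (k + 1) (i + w) := by
  induction k with
  | zero =>
    intro i w hw
    have hi : (⟨min (i + w) d, by omega⟩ : Fin (d + 1)) = i := Fin.ext (by simp; omega)
    simp [greedyMonomial, hi]
  | succ k ih =>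
    intro i w hw
    have hw' : w ≤ d * k + d := by rwa [mul_add, mul_one] at hw
    rw [greedyMonomial, greedyMonomial, ← mul_assoc,
      mul_eq_mul_of_hankelMinor_eq_zero hu i ⟨min w d, by omega⟩ ⟨min (i + w) d, by omega⟩
        ⟨i + min w d - min (i + w) d, by omega⟩ (by simp; omega), mul_assoc, ih _ _ (by omega)]
    congr 2
    simp; omega

theorem prod_map_eq_greedyMonomial {R : Type*} [CommRing R] {d : ℕ} {u : Fin (d + 1) → R}
    (hu : ∀ p, hankelMinor u p = 0) (S : Multiset (Fin (d + 1))) :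
    (S.map u).prod = greedyMonomial u S.card (S.map Fin.val).sum ∧
      (S.map Fin.val).sum ≤ d * S.card := by
  induction S using Multiset.induction_on with
  | empty => simp [greedyMonomial]
  | cons i S ih =>
    have hi : (i : ℕ) ≤ d := by omega
    simp only [Multiset.map_cons, Multiset.prod_cons, Multiset.sum_cons, Multiset.card_cons]
    exact ⟨by rw [ih.1, mul_greedyMonomial hu _ _ _ ih.2], by
      rw [mul_add, mul_one]; exact (add_le_add hi ih.2).trans_eq (add_comm _ _)⟩

/-! ### The ideal of the standard rational normal curve -/

open MvPolynomial

/-- The ring map dual to the parametrization of the cone over the standard rational normal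
curve, `u i ↦ s ^ (d - i) * t ^ i`. -/
noncomputable def veroneseHom (K : Type*) [CommRing K] (d : ℕ) :
    MvPolynomial (Fin (d + 1)) K →ₐ[K] MvPolynomial (Fin 2) K :=
  aeval fun i => X 0 ^ (d - (i : ℕ)) * X 1 ^ (i : ℕ)

theorem monomial_toFinsupp_eq_prod {K ι : Type*} [CommRing K] [DecidableEq ι] (S : Multiset ι) :
    monomial (Multiset.toFinsupp S) (1 : K) = (S.map X).prod := by
  induction S using Multiset.induction_on with
  | empty => simp
  | cons i S ih =>
    rw [← Multiset.singleton_add, map_add, Multiset.map_add, Multiset.prod_add, ← ih,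
      Multiset.toFinsupp_singleton, Multiset.map_singleton, Multiset.prod_singleton, X,
      monomial_mul, one_mul]

theorem veroneseHom_prod_map_X {K : Type*} [CommRing K] {d : ℕ} (S : Multiset (Fin (d + 1))) :
    ∃ a, veroneseHom K d (S.map X).prod = X 0 ^ a * X 1 ^ (S.map Fin.val).sum ∧
      a + (S.map Fin.val).sum = d * S.card := by
  induction S using Multiset.induction_on with
  | empty => exact ⟨0, by simp⟩
  | cons i S ih =>
    obtain ⟨a, h1, h2⟩ := ih
    refine ⟨d - i + a, ?_, ?_⟩
    · rw [Multiset.map_cons, Multiset.prod_cons, map_mul, h1, veroneseHom, aeval_X,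
        Multiset.map_cons, Multiset.sum_cons]
      ring
    · have hi : (i : ℕ) ≤ d := by omega
      simp only [Multiset.map_cons, Multiset.sum_cons, Multiset.card_cons, mul_add, mul_one]
      omega

/-- A relation between the monomials `s ^ (d - i) * t ^ i` holds in every algebra in which the
Hankel minors vanish. Sending `s ^ a * t ^ b` to the normal form of degree `(a + b) / d` and
weight `b` defines a linear map through which evaluation at `u` factors. -/
theorem aeval_eq_zero_of_veroneseHom_eq_zero {K Q : Type*} [CommRing K] [CommRing Q] [Algebra K Q]
    {d : ℕ} (hd : 0 < d) {u : Fin (d + 1) → Q} (hu : ∀ p, hankelMinor u p = 0)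
    {g : MvPolynomial (Fin (d + 1)) K} (hg : veroneseHom K d g = 0) : aeval u g = 0 := by
  let ρ : MvPolynomial (Fin 2) K →ₗ[K] Q :=
    (basisMonomials (Fin 2) K).constr K fun e => greedyMonomial u ((e 0 + e 1) / d) (e 1)
  have hρ : ∀ a b : ℕ, ρ (X 0 ^ a * X 1 ^ b) = greedyMonomial u ((a + b) / d) b := by
    intro a b
    have h1 : (X 0 ^ a * X 1 ^ b : MvPolynomial (Fin 2) K) =
        basisMonomials (Fin 2) K (Finsupp.single 0 a + Finsupp.single 1 b) := by
      simp [coe_basisMonomials, X_pow_eq_monomial, monomial_mul]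
    rw [h1]
    simp only [ρ, Module.Basis.constr_basis]
    simp
  have key : ρ ∘ₗ (veroneseHom K d).toLinearMap = (aeval u).toLinearMap := by
    refine (basisMonomials (Fin (d + 1)) K).ext fun m => ?_
    obtain ⟨S, rfl⟩ := Multiset.toFinsupp.surjective m
    simp only [coe_basisMonomials, LinearMap.comp_apply, AlgHom.toLinearMap_apply]
    rw [monomial_toFinsupp_eq_prod]
    obtain ⟨a, h1, h2⟩ := veroneseHom_prod_map_X (K := K) S
    rw [h1, hρ, h2, Nat.mul_div_cancel_left _ hd, ← (prod_map_eq_greedyMonomial hu S).1,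
      map_multiset_prod, Multiset.map_map]
    simp
  have h := LinearMap.congr_fun key g
  simpa [hg] using h.symm

/-- The coefficient of `X a * X (b + 1)`, `a < b`, in the minor of the columns `i < j` is `1` for
`(i, j) = (a, b)`, `-1` for `(i, j) = (a - 1, b + 1)` and `0` otherwise, so the minors are in
echelon form with respect to the first column. -/
theorem linearIndependent_hankelMinor_X (K : Type*) [CommRing K] (d : ℕ) :
    LinearIndependent K (hankelMinor (X : Fin (d + 1) → MvPolynomial (Fin (d + 1)) K)) := by
  rw [Fintype.linearIndependent_iff]
  intro c hc
  have hco : ∀ i j a b : Fin (d + 1), a < b → coeff (Finsupp.single a 1 + Finsupp.single b 1)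
      (X i * X j : MvPolynomial (Fin (d + 1)) K) =
        if (i = a ∧ j = b) ∨ (i = b ∧ j = a) then 1 else 0 := by
    intro i j a b hab
    rw [X, X, monomial_mul, coeff_monomial, one_mul]
    refine if_congr ?_ rfl rfl
    constructor
    · intro h
      have ha := DFunLike.congr_fun h a
      have hb := DFunLike.congr_fun h b
      simp only [Finsupp.add_apply, Finsupp.single_apply, if_neg hab.ne, if_neg hab.ne', if_true]
        at ha hb
      by_cases h1 : i = a <;> by_cases h2 : j = b <;> by_cases h3 : i = b <;>
        by_cases h4 : j = a <;> simp_all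
    · rintro (⟨rfl, rfl⟩ | ⟨rfl, rfl⟩)
      · rfl
      · exact add_comm _ _
  suffices H : ∀ (k : ℕ) (p : ColumnPairs d), (p.1.1 : ℕ) = k → c p = 0 from fun p => H _ p rfl
  intro k
  induction k using Nat.strong_induction_on with
  | _ k ih =>
    rintro p hp
    have hlt : p.1.1.castSucc < p.1.2.succ := by
      have := p.2
      simp only [Fin.lt_def, Fin.val_castSucc, Fin.val_succ] at this ⊢
      omega
    have h := congrArg
      (coeff (Finsupp.single p.1.1.castSucc 1 + Finsupp.single p.1.2.succ 1)) hc
    rw [coeff_sum, Finset.sum_eq_single p] at h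
    · have hpp := p.2
      rw [coeff_smul, hankelMinor_apply, coeff_sub, hco _ _ _ _ hlt, hco _ _ _ _ hlt,
        if_pos (Or.inl ⟨rfl, rfl⟩), if_neg, sub_zero, smul_eq_mul, mul_one, coeff_zero] at h
      · exact h
      · simp only [Fin.ext_iff, Fin.lt_def, Fin.val_castSucc, Fin.val_succ] at hpp ⊢
        omega
    · intro q _ hq
      by_cases hqk : (q.1.1 : ℕ) < k
      · rw [ih _ hqk q rfl, zero_smul, coeff_zero]
      · have hqq := q.2
        have hpp := p.2
        have hne : ¬ ((q.1.1 : ℕ) = p.1.1 ∧ (q.1.2 : ℕ) = p.1.2) := fun h =>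
          hq (Subtype.ext (Prod.ext (Fin.ext h.1) (Fin.ext h.2)))
        rw [coeff_smul, hankelMinor_apply, coeff_sub, hco _ _ _ _ hlt, hco _ _ _ _ hlt, if_neg,
          if_neg, sub_zero, smul_zero]
        all_goals
          simp only [Fin.ext_iff, Fin.lt_def, Fin.val_castSucc, Fin.val_succ] at hqq hpp ⊢
          omega
    · simp

/-- The cone over the standard rational normal curve is cut out by the Hankel minors. -/
theorem exists_eq_pow_mul_pow_of_hankelMinor_eq_zero {K : Type*} [Field K] {d : ℕ}
    {x : Fin (d + 1) → K} (hx0 : x ≠ 0) (hx : ∀ p, hankelMinor x p = 0) :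
    ∃ (c s t : K), (s ≠ 0 ∨ t ≠ 0) ∧
      ∀ i : Fin (d + 1), x i = c * (s ^ (d - (i : ℕ)) * t ^ (i : ℕ)) := by
  by_cases h0 : x 0 = 0
  · -- `x k ^ 2 = x (k - 1) * x (k + 1)` forces all coordinates but the last one to vanish.
    have hz : ∀ k : ℕ, ∀ hk : k < d, x ⟨k, by omega⟩ = 0 := by
      intro k
      induction k with
      | zero => intro _; exact h0
      | succ k ih =>
        intro hk
        have := mul_eq_mul_of_hankelMinor_eq_zero hx ⟨k + 1, by omega⟩ ⟨k + 1, by omega⟩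
          ⟨k, by omega⟩ ⟨k + 2, by omega⟩ (by simp; omega)
        rw [ih (by omega), zero_mul] at this
        exact mul_self_eq_zero.mp this
    refine ⟨x (Fin.last d), 0, 1, Or.inr one_ne_zero, fun i => ?_⟩
    rcases lt_or_ge (i : ℕ) d with hi | hi
    · rw [zero_pow (by omega), zero_mul, mul_zero]
      exact hz i hi
    · have : i = Fin.last d := Fin.ext (by simp; omega)
      subst this
      simp
  · rcases Nat.eq_zero_or_pos d with rfl | hd
    · refine ⟨x 0, 1, 1, Or.inl one_ne_zero, fun i => ?_⟩
      rw [show i = 0 from Fin.ext (by simp)]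
      simp
    · refine ⟨x 0, 1, x ⟨1, by omega⟩ / x 0, Or.inl one_ne_zero, ?_⟩
      have hr : ∀ k : ℕ, ∀ hk : k < d + 1,
          x ⟨k, hk⟩ = x 0 * (x ⟨1, by omega⟩ / x 0) ^ k := by
        intro k
        induction k with
        | zero => intro _; simp
        | succ k ih =>
          intro hk
          have := mul_eq_mul_of_hankelMinor_eq_zero hx ⟨k + 1, hk⟩ 0 ⟨1, by omega⟩
            ⟨k, by omega⟩ (by simp; omega)
          rw [ih (by omega)] at this
          rw [eq_div_of_mul_eq h0 this, pow_succ]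
          field_simp
      intro i
      rw [one_pow, one_mul]
      exact hr i i.2

/-! ### Jordan form and minimal polynomial -/

theorem jordanBlock_zero_pow_apply (e k : ℕ) (i j : Fin e) :
    (jordanBlock e 0 ^ k) i j = if (i : ℕ) + k = j then 1 else 0 := by
  induction k generalizing i with
  | zero => simp [Matrix.one_apply, Fin.ext_iff]
  | succ k ih =>
    have hJ : ∀ a b : Fin e, jordanBlock e 0 a b = if (a : ℕ) + 1 = b then 1 else 0 := by
      intro a b
      by_cases hab : a = b <;> simp [jordanBlock, hab]
    rw [pow_succ', Matrix.mul_apply]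
    simp only [ih, hJ]
    by_cases h : (i : ℕ) + 1 < e
    · rw [Finset.sum_eq_single ⟨i + 1, h⟩]
      · have h1 : i ≠ ⟨i + 1, h⟩ := fun h2 => by simpa using congrArg Fin.val h2
        simp [add_assoc, add_comm 1 k]
      · intro b _ hb
        have : (i : ℕ) + 1 ≠ b := fun h2 => hb (Fin.ext h2.symm)
        simp [this]
      · simp
    · rw [if_neg (by omega)]
      refine Finset.sum_eq_zero fun b _ => ?_
      have : (i : ℕ) + 1 ≠ b := by omega
      simp [this]

theorem aeval_jordanBlock_zero_apply (e : ℕ) (q : Polynomial ℂ) (i j : Fin e) :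
    Polynomial.aeval (jordanBlock e 0) q i j = if (i : ℕ) ≤ j then q.coeff (j - i) else 0 := by
  rw [Polynomial.aeval_eq_sum_range, Matrix.sum_apply]
  simp only [Matrix.smul_apply, jordanBlock_zero_pow_apply, smul_eq_mul, mul_ite, mul_one, mul_zero]
  split_ifs with h
  · rw [Finset.sum_eq_single ((j : ℕ) - i)]
    · rw [if_pos (by omega)]
    · intro b _ hb
      rw [if_neg (by omega)]
    · intro hb
      rw [if_pos (by omega)]
      exact Polynomial.coeff_eq_zero_of_natDegree_lt (by simp at hb; omega)
  · exact Finset.sum_eq_zero fun b _ => if_neg (by omega)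

theorem jordanBlock_eq_add_algebraMap (e : ℕ) (a : ℂ) :
    jordanBlock e a = jordanBlock e 0 + algebraMap ℂ _ a := by
  ext i j
  by_cases h : i = j
  · simp [jordanBlock, h, Matrix.algebraMap_matrix_apply]
  · simp [jordanBlock, h, Matrix.algebraMap_matrix_apply]

theorem aeval_jordanBlock_eq_zero_iff (e : ℕ) (a : ℂ) (q : Polynomial ℂ) :
    Polynomial.aeval (jordanBlock e a) q = 0 ↔ (Polynomial.X - Polynomial.C a) ^ e ∣ q := by
  have h1 : Polynomial.aeval (jordanBlock e a) q =
      Polynomial.aeval (jordanBlock e 0) (q.comp (Polynomial.X + Polynomial.C a)) := by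
    rw [Polynomial.aeval_comp, map_add, Polynomial.aeval_X, Polynomial.aeval_C,
      ← jordanBlock_eq_add_algebraMap]
  rw [h1, Polynomial.X_sub_C_pow_dvd_iff, Polynomial.X_pow_dvd_iff]
  constructor
  · intro h k hk
    have := congrFun (congrFun h ⟨0, by omega⟩) ⟨k, hk⟩
    rw [aeval_jordanBlock_zero_apply] at this
    simpa using this
  · intro h
    ext i j
    rw [aeval_jordanBlock_zero_apply, Matrix.zero_apply]
    split_ifs
    · exact h _ (by omega)
    · rfl

theorem aeval_blockDiagonal' {s : ℕ} {e : Fin s → ℕ} (J : ∀ k, Matrix (Fin (e k)) (Fin (e k)) ℂ)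
    (q : Polynomial ℂ) : Polynomial.aeval (Matrix.blockDiagonal' J) q =
      Matrix.blockDiagonal' fun k => Polynomial.aeval (J k) q := by
  let φ : (∀ k, Matrix (Fin (e k)) (Fin (e k)) ℂ) →ₐ[ℂ]
      Matrix (Σ k, Fin (e k)) (Σ k, Fin (e k)) ℂ :=
    { Matrix.blockDiagonal'RingHom (fun k => Fin (e k)) ℂ with
      commutes' := fun r => by
        change Matrix.blockDiagonal' (algebraMap ℂ (∀ k, Matrix (Fin (e k)) (Fin (e k)) ℂ) r) = _
        rw [Algebra.algebraMap_eq_smul_one, Matrix.blockDiagonal'_smul, Matrix.blockDiagonal'_one,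
          Algebra.algebraMap_eq_smul_one] }
  change Polynomial.aeval (φ J) q = φ (fun k => Polynomial.aeval (J k) q)
  rw [Polynomial.aeval_algHom_apply]
  congr 1
  ext1 k
  exact (Polynomial.aeval_algHom_apply
    (Pi.evalAlgHom ℂ (fun k => Matrix (Fin (e k)) (Fin (e k)) ℂ) k) J q).symm

theorem aeval_conj_matrix {n : ℕ} {P : Matrix (Fin n) (Fin n) ℂ} (hP : P.det ≠ 0)
    (N : Matrix (Fin n) (Fin n) ℂ) (q : Polynomial ℂ) :
    Polynomial.aeval (P * N * P⁻¹) q = P * Polynomial.aeval N q * P⁻¹ := by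
  have hP' : P⁻¹ * P = 1 := Matrix.nonsing_inv_mul P (isUnit_iff_ne_zero.mpr hP)
  have hP'' : P * P⁻¹ = 1 := Matrix.mul_nonsing_inv P (isUnit_iff_ne_zero.mpr hP)
  induction q using Polynomial.induction_on' with
  | add p q hp hq => rw [map_add, hp, hq, map_add, mul_add, add_mul]
  | monomial k a =>
    have hk : (P * N * P⁻¹) ^ k = P * N ^ k * P⁻¹ := by
      induction k with
      | zero => simp [hP'']
      | succ k ih =>
        rw [pow_succ, ih, pow_succ]
        calc P * N ^ k * P⁻¹ * (P * N * P⁻¹) = P * N ^ k * (P⁻¹ * P) * N * P⁻¹ := by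
              simp only [mul_assoc]
          _ = _ := by rw [hP', mul_one]; simp only [mul_assoc]
    simp only [Polynomial.aeval_monomial, hk, ← Algebra.smul_def]
    simp

theorem aeval_eq_zero_iff_of_hasJordanForm {n : ℕ} {M : Matrix (Fin n) (Fin n) ℂ} {s : ℕ}
    {α : Fin s → ℂ} {e : Fin s → ℕ} (h : HasJordanForm M α e) (q : Polynomial ℂ) :
    Polynomial.aeval M q = 0 ↔ ∀ k, (Polynomial.X - Polynomial.C (α k)) ^ e k ∣ q := by
  obtain ⟨-, f, P, hP, rfl⟩ := h
  have hP' : IsUnit P := (Matrix.isUnit_iff_isUnit_det P).mpr (isUnit_iff_ne_zero.mpr hP)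
  have hPi : IsUnit P⁻¹ := (Matrix.isUnit_nonsing_inv_iff).mpr hP'
  rw [aeval_conj_matrix hP, hPi.mul_left_eq_zero, hP'.mul_right_eq_zero,
    ← Matrix.coe_reindexAlgEquiv ℂ ℂ f, Polynomial.aeval_algHom_apply, aeval_blockDiagonal',
    EmbeddingLike.map_eq_zero_iff, ← Matrix.blockDiagonal'_zero,
    Matrix.blockDiagonal'_injective.eq_iff, funext_iff]
  exact forall_congr' fun k => aeval_jordanBlock_eq_zero_iff _ _ _

/-- The largest block size of each eigenvalue is its multiplicity as a root of the minimal
polynomial. -/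
theorem sumFirstParts_eq_natDegree_minpoly {n : ℕ} {M : Matrix (Fin n) (Fin n) ℂ} {s : ℕ}
    {α : Fin s → ℂ} {e : Fin s → ℕ} (h : HasJordanForm M α e) :
    sumFirstParts (blockPartitions α e) = (minpoly ℂ M).natDegree := by
  classical
  let w : ℂ → ℕ := fun a => (Finset.univ.filter fun k => α k = a).sup e
  let p : Polynomial ℂ :=
    ∏ a ∈ Finset.univ.image α, (Polynomial.X - Polynomial.C a) ^ w a
  have hp : p.Monic :=
    Polynomial.monic_prod_of_monic _ _ fun a _ => (Polynomial.monic_X_sub_C a).pow _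
  have hdvd : ∀ q, Polynomial.aeval M q = 0 ↔ p ∣ q := by
    intro q
    rw [aeval_eq_zero_iff_of_hasJordanForm h]
    constructor
    · intro hq
      refine Finset.prod_dvd_of_coprime ?_ ?_
      · intro a _ b _ hab
        exact (Polynomial.isCoprime_X_sub_C_of_isUnit_sub
          (isUnit_iff_ne_zero.mpr (sub_ne_zero.mpr hab))).pow
      · intro a ha
        obtain ⟨k, -, rfl⟩ := Finset.mem_image.mp ha
        obtain ⟨k', hk', h'⟩ := Finset.exists_mem_eq_sup
          (Finset.univ.filter fun k' => α k' = α k) ⟨k, by simp⟩ e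
        change _ ^ Finset.sup _ e ∣ q
        rw [h', ← (Finset.mem_filter.mp hk').2]
        exact hq k'
    · intro hq k
      refine (pow_dvd_pow _ ?_).trans ((Finset.dvd_prod_of_mem
        (fun a => (Polynomial.X - Polynomial.C a) ^ w a)
        (Finset.mem_image_of_mem α (Finset.mem_univ k))).trans hq)
      exact Finset.le_sup (f := e) (by simp)
  have hmin : p = minpoly ℂ M :=
    minpoly.unique ℂ M hp ((hdvd p).mpr dvd_rfl) fun q hq h0 =>
      Polynomial.degree_le_of_dvd ((hdvd q).mp h0) hq.ne_zero
  rw [← hmin, Polynomial.natDegree_prod_of_monic _ _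
    fun a _ => (Polynomial.monic_X_sub_C a).pow _]
  simp only [Polynomial.natDegree_pow, Polynomial.natDegree_X_sub_C, mul_one, sumFirstParts,
    blockPartitions, Multiset.map_map]
  rfl

/-! ### The resolvent of a matrix -/

/-- The value at `x` of the polynomial obtained from the minimal polynomial `μ` of `x` by
deleting the terms of degree less than `i` and dividing by `X ^ i`. For `1 ≤ i ≤ deg μ` these are
the coefficients in `T` of the quotient of `μ(T)` by `T - x`. -/
noncomputable def minpolyQuotient (K : Type*) {A : Type*} [Field K] [Ring A] [Algebra K A]
    (x : A) (i : ℕ) : A :=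
  Polynomial.aeval x (Polynomial.divX^[i] (minpoly K x))

/-- The value at `(s, t)` of the homogenization of the minimal polynomial of `x`, in which `t`
stands for the variable. -/
noncomputable def minpolyHomogEval (K : Type*) {A : Type*} [Field K] [Ring A] [Algebra K A]
    (x : A) (s t : K) : K :=
  ∑ i ∈ Finset.range ((minpoly K x).natDegree + 1),
    (minpoly K x).coeff i * (s ^ ((minpoly K x).natDegree - i) * t ^ i)

section MinpolyQuotient

variable {K A : Type*} [Field K] [Ring A] [Algebra K A]

theorem coeff_iterate_divX (p : Polynomial K) (i j : ℕ) :
    (Polynomial.divX^[i] p).coeff j = p.coeff (j + i) := by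
  induction i generalizing j with
  | zero => rfl
  | succ i ih => rw [Function.iterate_succ_apply', Polynomial.coeff_divX, ih]; congr 1; omega

theorem minpolyQuotient_zero (x : A) : minpolyQuotient K x 0 = 0 := minpoly.aeval K x

theorem minpolyQuotient_eq (x : A) (i : ℕ) : minpolyQuotient K x i =
    x * minpolyQuotient K x (i + 1) + (minpoly K x).coeff i • 1 := by
  have h := Polynomial.divX_mul_X_add (Polynomial.divX^[i] (minpoly K x))
  rw [coeff_iterate_divX, zero_add, ← Function.iterate_succ_apply' Polynomial.divX i,
    mul_comm] at h
  rw [minpolyQuotient, minpolyQuotient, ← h, map_add, map_mul, Polynomial.aeval_X,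
    Polynomial.aeval_C, Algebra.algebraMap_eq_smul_one]

theorem minpolyQuotient_natDegree {x : A} (hx : IsIntegral K x) :
    minpolyQuotient K x (minpoly K x).natDegree = 1 := by
  have : Polynomial.divX^[(minpoly K x).natDegree] (minpoly K x) = 1 := by
    ext j
    rw [coeff_iterate_divX, Polynomial.coeff_one]
    rcases Nat.eq_zero_or_pos j with rfl | hj
    · rw [zero_add, if_pos rfl]
      exact (minpoly.monic hx).coeff_natDegree
    · rw [if_neg hj.ne']
      exact Polynomial.coeff_eq_zero_of_natDegree_lt (by omega)
  rw [minpolyQuotient, this, map_one]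

/-- The resolvent identity: homogenization in `T = t / s` of
`(T - x) * ((μ(T) - μ(x)) / (T - x)) = μ(T)`. -/
theorem sub_mul_sum_minpolyQuotient {x : A} (hx : IsIntegral K x) {d : ℕ}
    (hd : (minpoly K x).natDegree = d + 1) (s t : K) :
    (t • 1 - s • x) * ∑ i : Fin (d + 1),
      (s ^ (d - (i : ℕ)) * t ^ (i : ℕ)) • minpolyQuotient K x (i + 1) =
        minpolyHomogEval K x s t • 1 := by
  -- The sum telescopes, because `x * Q (i + 1) = Q i - μ i` for the quotients `Q`.
  let g : ℕ → A := fun i => (s ^ (d + 1 - i) * t ^ i) • minpolyQuotient K x i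
  have hg : ∑ i ∈ Finset.range (d + 1), (g (i + 1) - g i) = t ^ (d + 1) • 1 := by
    rw [Finset.sum_range_sub]
    simp only [g]
    rw [minpolyQuotient_zero, smul_zero, sub_zero, ← hd, minpolyQuotient_natDegree hx]
    simp
  have hc : (minpoly K x).coeff (d + 1) = 1 := by
    rw [← hd]; exact (minpoly.monic hx).coeff_natDegree
  rw [minpolyHomogEval, hd, Finset.sum_range_succ, hc, Nat.sub_self, pow_zero, one_mul, one_mul,
    add_smul, ← hg, Finset.sum_smul, ← Finset.sum_add_distrib,
    Fin.sum_univ_eq_sum_range (fun i => (s ^ (d - i) * t ^ i) • minpolyQuotient K x (i + 1)),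
    Finset.mul_sum]
  refine Finset.sum_congr rfl fun i hi => ?_
  have hi' : d + 1 - i = d - i + 1 := by have := Finset.mem_range.mp hi; omega
  simp only [g]
  rw [minpolyQuotient_eq x i, hi', show d + 1 - (i + 1) = d - i by omega]
  have e1 : s ^ (d - i) * t ^ (i + 1) = s ^ (d - i) * t ^ i * t := by ring
  have e2 : s ^ (d - i + 1) * t ^ i = s ^ (d - i) * t ^ i * s := by ring
  rw [e1, e2]
  simp only [sub_mul, smul_mul_assoc, mul_smul_comm, one_mul]
  module

/-- The polynomials defining `minpolyQuotient` have distinct degrees less than that of the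
minimal polynomial. -/
theorem linearIndependent_minpolyQuotient {x : A} (hx : IsIntegral K x) {d : ℕ}
    (hd : (minpoly K x).natDegree = d + 1) :
    LinearIndependent K fun i : Fin (d + 1) => minpolyQuotient K x (i + 1) := by
  rw [Fintype.linearIndependent_iff]
  intro a ha
  let P : Polynomial K := ∑ i : Fin (d + 1), a i • Polynomial.divX^[(i : ℕ) + 1] (minpoly K x)
  have hco : ∀ j, P.coeff j = ∑ i : Fin (d + 1), a i * (minpoly K x).coeff (j + (i + 1)) := by
    intro j
    simp only [P, Polynomial.finsetSum_coeff, Polynomial.coeff_smul, coeff_iterate_divX,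
      smul_eq_mul]
  have hP : P = 0 := by
    by_contra hP
    have hle := minpoly.degree_le_of_ne_zero K x hP (by
      simp only [P, map_sum, map_smul]
      exact ha)
    have hlt : P.degree < (minpoly K x).degree := by
      rw [Polynomial.degree_eq_natDegree (minpoly.ne_zero hx), hd,
        Polynomial.degree_lt_iff_coeff_zero]
      intro j hj
      rw [hco]
      refine Finset.sum_eq_zero fun i _ => ?_
      rw [Polynomial.coeff_eq_zero_of_natDegree_lt (by omega), mul_zero]
    exact absurd hle (not_le.mpr hlt)
  suffices H : ∀ (k : ℕ) (i : Fin (d + 1)), (i : ℕ) = k → a i = 0 from fun i => H _ i rfl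
  intro k
  induction k using Nat.strong_induction_on with
  | _ k ih =>
    rintro i rfl
    -- In degree `d - i`, the summands after the `i`-th contribute nothing.
    have h := hco (d - i)
    rw [hP, Polynomial.coeff_zero, Finset.sum_eq_single i] at h
    · rw [show d - (i : ℕ) + (i + 1) = d + 1 by omega, ← hd,
        (minpoly.monic hx).coeff_natDegree, mul_one] at h
      exact h.symm
    · intro b _ hb
      rcases lt_trichotomy (b : ℕ) i with hbi | hbi | hbi
      · rw [ih _ hbi b rfl, zero_mul]
      · exact absurd (Fin.ext hbi) hb
      · rw [Polynomial.coeff_eq_zero_of_natDegree_lt (by omega), mul_zero]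
    · simp

end MinpolyQuotient

/-- For symmetric `A` and `B`, all polynomials in `A * B⁻¹` become symmetric when multiplied by
`B⁻¹` from the left. -/
theorem isSymm_inv_mul_aeval {n : ℕ} {A B : Matrix (Fin n) (Fin n) ℂ} (hA : A.IsSymm)
    (hB : B.IsSymm) (q : Polynomial ℂ) :
    (B⁻¹ * Polynomial.aeval (A * B⁻¹) q).IsSymm := by
  have hBi : (B⁻¹).transpose = B⁻¹ := by rw [Matrix.transpose_nonsing_inv, hB.eq]
  induction q using Polynomial.induction_on' with
  | add p q hp hq => rw [map_add, mul_add]; exact hp.add hq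
  | monomial k a =>
    rw [Polynomial.aeval_monomial, ← Algebra.smul_def, Matrix.mul_smul]
    refine Matrix.IsSymm.smul ?_ a
    induction k with
    | zero => rw [pow_zero, mul_one]; exact hBi
    | succ k ih =>
      have h : B⁻¹ * (A * B⁻¹) ^ (k + 1) = B⁻¹ * A * (B⁻¹ * (A * B⁻¹) ^ k) := by
        rw [pow_succ']; simp only [mul_assoc]
      rw [Matrix.IsSymm]
      nth_rewrite 1 [h]
      rw [Matrix.transpose_mul, ih.eq, Matrix.transpose_mul, hA.eq, hBi, pow_succ]
      simp only [mul_assoc]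

/-! ### Rational normal curves in the span of a family -/

section LinearForms

variable {K ι J : Type*} [Field K] [Fintype ι]

/-- The coordinate function of a basis of `ι → K`, as a linear form in the unknowns `X p`. -/
noncomputable def coordForm [DecidableEq ι] (b : Module.Basis J K (ι → K)) (j : J) :
    MvPolynomial ι K :=
  ∑ p, C (b.coord j (Pi.single p 1)) * X p

variable [DecidableEq ι] (b : Module.Basis J K (ι → K))

theorem eval_coordForm (j : J) (w : ι → K) : eval w (coordForm b j) = b.coord j w := by
  rw [coordForm, map_sum]
  conv_rhs => rw [pi_eq_sum_univ' w, map_sum]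
  refine Finset.sum_congr rfl fun p _ => ?_
  rw [map_mul, eval_C, eval_X, map_smul, smul_eq_mul, mul_comm]

theorem isHomogeneous_coordForm (j : J) : (coordForm b j).IsHomogeneous 1 :=
  IsHomogeneous.sum _ _ _ fun p _ => by
    simpa using (isHomogeneous_C ι (b.coord j (Pi.single p 1))).mul (isHomogeneous_X K p)

theorem linearIndependent_coordForm [Fintype J] : LinearIndependent K (coordForm b) := by
  classical
  rw [Fintype.linearIndependent_iff]
  intro c hc j
  have h := congrArg (eval (b j)) hc
  simpa [smul_eval, eval_coordForm, Finsupp.single_apply] using h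

theorem X_eq_sum_coordForm [Fintype J] [Infinite K] (p : ι) :
    X p = ∑ j, C (b j p) * coordForm b j := by
  refine MvPolynomial.funext fun w => ?_
  have h := congrFun (b.sum_repr w) p
  rw [Finset.sum_apply] at h
  simp only [eval_X, map_sum, map_mul, eval_C, eval_coordForm]
  rw [← h]
  exact Finset.sum_congr rfl fun j _ => by simp [mul_comm]

end LinearForms

theorem linearIndependent_hankelMinor_of_map_eq_X {K R : Type*} [CommRing K] [CommRing R]
    [Algebra K R] {d : ℕ} (φ : R →ₐ[K] MvPolynomial (Fin (d + 1)) K) {u : Fin (d + 1) → R}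
    (hu : ∀ i, φ (u i) = X i) : LinearIndependent K (hankelMinor u) := by
  have hX : φ.toLinearMap ∘ hankelMinor u =
      hankelMinor (X : Fin (d + 1) → MvPolynomial (Fin (d + 1)) K) := by
    ext1 p
    have := map_hankelMinor φ.toRingHom u p
    simp only [AlgHom.toRingHom_eq_coe, RingHom.coe_coe, hu] at this
    exact this
  refine LinearIndependent.of_comp φ.toLinearMap ?_
  rw [hX]
  exact linearIndependent_hankelMinor_X K d

section SpanHom

variable {K ι : Type*} [Field K] {d : ℕ}

/-- Restriction of polynomial functions along the linear map `y ↦ ∑ i, y i • v i`. -/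
noncomputable def spanHom (v : Fin (d + 1) → ι → K) :
    MvPolynomial ι K →ₐ[K] MvPolynomial (Fin (d + 1)) K :=
  aeval fun p => ∑ i, C (v i p) * X i

theorem eval_spanHom (v : Fin (d + 1) → ι → K) (y : Fin (d + 1) → K) (f : MvPolynomial ι K) :
    eval y (spanHom v f) = eval (∑ i, y i • v i) f := by
  induction f using MvPolynomial.induction_on with
  | C a => simp [spanHom]
  | add f g hf hg => simp only [map_add, hf, hg]
  | mul_X f p hf =>
    rw [map_mul, map_mul, hf, map_mul]
    simp [spanHom, mul_comm]

theorem eval_veroneseHom (y : Fin 2 → K) (g : MvPolynomial (Fin (d + 1)) K) :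
    eval y (veroneseHom K d g) =
      eval (fun i : Fin (d + 1) => y 0 ^ (d - (i : ℕ)) * y 1 ^ (i : ℕ)) g := by
  induction g using MvPolynomial.induction_on with
  | C a => simp [veroneseHom]
  | add f g hf hg => simp only [map_add, hf, hg]
  | mul_X f p hf =>
    rw [map_mul, map_mul, hf, map_mul]
    simp [veroneseHom]

theorem hankelMinor_veronese {R : Type*} [CommRing R] (s t : R) (p : ColumnPairs d) :
    hankelMinor (fun i : Fin (d + 1) => s ^ (d - (i : ℕ)) * t ^ (i : ℕ)) p = 0 := by
  obtain ⟨⟨i, j⟩, h⟩ := p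
  have hi : d - (i : ℕ) = d - (i + 1) + 1 := by omega
  have hj : d - (j : ℕ) = d - (j + 1) + 1 := by omega
  simp only [hankelMinor_apply, Fin.val_castSucc, Fin.val_succ, hi, hj]
  ring

/-- Generators of the ideal of the cone over a rational normal curve spanning the linear span of
a family `v`: extend `v` to a basis of the ambient space. The coordinates complementary to `v`
vanish on the curve, and modulo them every polynomial is a polynomial in the coordinates `u`
along `v`, so that the case of the standard curve applies. -/
theorem exists_generators_ker_veroneseHom_comp_spanHom [Infinite K] [Fintype ι] [DecidableEq ι]
    (hd : 0 < d) {v : Fin (d + 1) → ι → K} (hv : LinearIndependent K v) :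
    d + 1 ≤ Fintype.card ι ∧
    ∃ (l : Fin (Fintype.card ι - d - 1) → MvPolynomial ι K) (u : Fin (d + 1) → MvPolynomial ι K),
      (∀ k, (l k).IsHomogeneous 1) ∧ (∀ i, (u i).IsHomogeneous 1) ∧
      LinearIndependent K (Sum.elim l u) ∧ LinearIndependent K (hankelMinor u) ∧
      (∀ w, (∀ k, eval w (l k) = 0) → w = ∑ i, eval w (u i) • v i) ∧
      RingHom.ker ((veroneseHom K d).comp (spanHom v)) =
        Ideal.span (Set.range l ∪ Set.range (hankelMinor u)) := by
  have hcard : d + 1 ≤ Fintype.card ι := by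
    simpa using hv.fintype_card_le_finrank
  refine ⟨hcard, ?_⟩
  let b₀ := Module.Basis.sumExtend hv
  have hb₀ : ∀ i, b₀ (Sum.inl i) = v i := fun i => by
    simp only [b₀, Module.Basis.sumExtend, Module.Basis.reindex_apply,
      Module.Basis.extend_apply_self]
    rfl
  have hfin : Finite (Fin (d + 1) ⊕ Module.Basis.sumExtendIndex hv) :=
    Module.Finite.finite_basis b₀
  have hfin' : Finite (Module.Basis.sumExtendIndex hv) :=
    Finite.of_injective (Sum.inr : _ → Fin (d + 1) ⊕ Module.Basis.sumExtendIndex hv)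
      Sum.inr_injective
  let _ : Fintype (Module.Basis.sumExtendIndex hv) := Fintype.ofFinite _
  have hidx : Fintype.card (Module.Basis.sumExtendIndex hv) = Fintype.card ι - d - 1 := by
    have := Module.finrank_eq_card_basis b₀
    rw [Module.finrank_fintype_fun_eq_card, Fintype.card_sum, Fintype.card_fin] at this
    omega
  let b : Module.Basis (Fin (Fintype.card ι - d - 1) ⊕ Fin (d + 1)) K (ι → K) :=
    b₀.reindex ((Equiv.sumComm _ _).trans
      (Equiv.sumCongr (Fintype.equivFinOfCardEq hidx) (Equiv.refl _)))
  have hb : ∀ i, b (Sum.inr i) = v i := fun i => by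
    rw [← hb₀]
    simp [b]
  let l : Fin (Fintype.card ι - d - 1) → MvPolynomial ι K := fun k => coordForm b (Sum.inl k)
  let u : Fin (d + 1) → MvPolynomial ι K := fun i => coordForm b (Sum.inr i)
  have hlu : Sum.elim l u = coordForm b := by ext (k | i) <;> rfl
  have hsl : ∀ k, spanHom v (l k) = 0 := fun k => MvPolynomial.funext fun y => by
    rw [eval_spanHom, eval_coordForm, map_sum, map_zero]
    refine Finset.sum_eq_zero fun i _ => ?_
    rw [← hb, map_smul, Module.Basis.coord_apply, Module.Basis.repr_self]
    simp
  have hsu : ∀ i, spanHom v (u i) = X i := fun i => MvPolynomial.funext fun y => by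
    rw [eval_spanHom, eval_coordForm, map_sum, eval_X, Finset.sum_eq_single i]
    · rw [← hb, map_smul, Module.Basis.coord_apply, Module.Basis.repr_self]
      simp
    · intro j _ hj
      rw [← hb, map_smul, Module.Basis.coord_apply, Module.Basis.repr_self,
        Finsupp.single_eq_of_ne (by simpa using hj.symm), smul_zero]
    · simp
  refine ⟨l, u, fun k => isHomogeneous_coordForm b _, fun i => isHomogeneous_coordForm b _,
    hlu ▸ linearIndependent_coordForm b, ?_, ?_, ?_⟩
  · exact linearIndependent_hankelMinor_of_map_eq_X (spanHom v) hsu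
  · intro w hw
    conv_lhs => rw [← b.sum_repr w, Fintype.sum_sum_type]
    have h0 : ∀ k, b.repr w (Sum.inl k) = 0 := fun k => by
      rw [← Module.Basis.coord_apply, ← eval_coordForm]
      exact hw k
    simp only [h0, zero_smul, Finset.sum_const_zero, zero_add, hb, u, eval_coordForm,
      Module.Basis.coord_apply]
  · apply le_antisymm
    · intro f hf
      rw [RingHom.mem_ker] at hf
      set I := Ideal.span (Set.range l ∪ Set.range (hankelMinor u)) with hI
      let q := Ideal.Quotient.mkₐ K I
      have hq : ∀ g ∈ I, q g = 0 := fun g hg => Ideal.Quotient.eq_zero_iff_mem.mpr hg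
      have hmin : ∀ p, hankelMinor (fun i => q (u i)) p = 0 := fun p => by
        rw [← hq _ (Ideal.subset_span (Or.inr ⟨p, rfl⟩))]
        exact (map_hankelMinor q.toRingHom u p).symm
      -- Modulo the ideal, every polynomial is a polynomial in the `u i`.
      have hfac : q = (aeval fun i => q (u i)).comp (spanHom v) := by
        refine MvPolynomial.algHom_ext fun p => ?_
        conv_lhs => rw [X_eq_sum_coordForm b p, map_sum, Fintype.sum_sum_type]
        rw [Finset.sum_eq_zero, zero_add, AlgHom.comp_apply, spanHom, aeval_X, map_sum]
        · refine Finset.sum_congr rfl fun i _ => ?_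
          rw [map_mul, map_mul, aeval_X, hb]
          congr 1
          rw [← algebraMap_eq, ← algebraMap_eq, AlgHom.commutes, AlgHom.commutes]
        · intro k _
          rw [map_mul, hq (coordForm b (Sum.inl k)) (Ideal.subset_span (Or.inl ⟨k, rfl⟩)),
            mul_zero]
      refine Ideal.Quotient.eq_zero_iff_mem.mp ?_
      change q f = 0
      rw [hfac]
      exact aeval_eq_zero_of_veroneseHom_eq_zero hd hmin hf
    · rw [Ideal.span_le]
      rintro _ (⟨k, rfl⟩ | ⟨p, rfl⟩)
      · change veroneseHom K d (spanHom v (l k)) = 0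
        rw [hsl, map_zero]
      · change ((veroneseHom K d).comp (spanHom v)).toRingHom (hankelMinor u p) = 0
        rw [map_hankelMinor]
        simp only [AlgHom.toRingHom_eq_coe, RingHom.coe_coe, AlgHom.comp_apply, hsu, veroneseHom,
          aeval_X]
        exact hankelMinor_veronese _ _ p

end SpanHom

/-! ### Vanishing ideals and closures in the projective space of symmetric matrices -/

/-- The entries on and above the diagonal are coordinates on `𝕊ⁿ`. -/
noncomputable def symCoords (n : ℕ) : symMatrices n →ₗ[ℂ] (SymIndex n → ℂ) where
  toFun X p := toMat X p.1.1 p.1.2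
  map_add' _ _ := rfl
  map_smul' _ _ := rfl

theorem symCoords_injective (n : ℕ) : Function.Injective (symCoords n) := by
  intro X Y h
  have hXY : ∀ i j, i ≤ j → toMat X i j = toMat Y i j := fun i j hij => congrFun h ⟨(i, j), hij⟩
  refine Subtype.ext (Matrix.ext fun i j => ?_)
  rcases le_total i j with hij | hij
  · exact hXY i j hij
  · rw [← X.2.apply i j, ← Y.2.apply i j]
    exact hXY j i hij

theorem evalSym_eq {n : ℕ} (X : symMatrices n) (f : MvPolynomial (SymIndex n) ℂ) :
    evalSym X f = eval (symCoords n X) f := rfl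

theorem vanishingIdealProj_zariskiClosure {n : ℕ} (S : Set (ℙ ℂ (symMatrices n))) :
    vanishingIdealProj (zariskiClosure S) = vanishingIdealProj S := by
  apply le_antisymm
  · intro f hf X hX hS
    refine hf X hX fun g hg Y hY hYX => ?_
    exact hg Y hY (hYX ▸ hS)
  · intro f hf X hX hS
    exact hS f hf X hX rfl

/-- The point with parameters `(s, t)` of the cone over the rational normal curve in the span of
`Y`. -/
noncomputable def conePoint {n d : ℕ} (Y : Fin (d + 1) → symMatrices n) (s t : ℂ) :
    symMatrices n :=
  ∑ i : Fin (d + 1), (s ^ (d - (i : ℕ)) * t ^ (i : ℕ)) • Y i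

section Cone

variable {n d : ℕ} {Y : Fin (d + 1) → symMatrices n}

/-- Over `ℂ` every scalar is a `d`-th power, so the parametrized points form a cone. -/
theorem exists_smul_conePoint (hd : 0 < d) (c s t : ℂ) :
    ∃ r : ℂ, r ^ d = c ∧ c • conePoint Y s t = conePoint Y (r * s) (r * t) := by
  obtain ⟨r, rfl⟩ := IsAlgClosed.exists_pow_nat_eq c hd
  refine ⟨r, rfl, ?_⟩
  rw [conePoint, conePoint, Finset.smul_sum]
  refine Finset.sum_congr rfl fun i _ => ?_
  have hi : r ^ d = r ^ (d - (i : ℕ)) * r ^ (i : ℕ) := by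
    rw [← pow_add]; congr 1; omega
  rw [smul_smul, hi]
  congr 1
  ring

theorem eval_veroneseHom_spanHom (y : Fin 2 → ℂ) (f : MvPolynomial (SymIndex n) ℂ) :
    eval y (veroneseHom ℂ d (spanHom (fun i => symCoords n (Y i)) f)) =
      evalSym (conePoint Y (y 0) (y 1)) f := by
  rw [eval_veroneseHom, eval_spanHom, evalSym_eq, conePoint, map_sum]
  simp only [map_smul]

theorem veronese_ne_zero {s t : ℂ} (h : s ≠ 0 ∨ t ≠ 0) :
    (fun i : Fin (d + 1) => s ^ (d - (i : ℕ)) * t ^ (i : ℕ)) ≠ 0 := by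
  intro h0
  rcases h with h | h
  · exact pow_ne_zero d h (by simpa using congrFun h0 0)
  · exact pow_ne_zero d h (by simpa using congrFun h0 (Fin.last d))

/-- If the points of `S` are the points of the rational normal curve at which a nonzero form `h`
does not vanish, then `S` has the vanishing ideal of the whole curve. -/
theorem vanishingIdealProj_eq_ker {S : Set (ℙ ℂ (symMatrices n))} {h : MvPolynomial (Fin 2) ℂ}
    (h0 : h ≠ 0) (hne : ∀ y, eval y h ≠ 0 → conePoint Y (y 0) (y 1) ≠ 0)
    (hS : ∀ (X : symMatrices n) (hX : X ≠ 0), Projectivization.mk ℂ X hX ∈ S ↔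
      ∃ y : Fin 2 → ℂ, eval y h ≠ 0 ∧ X = conePoint Y (y 0) (y 1)) :
    vanishingIdealProj S =
      RingHom.ker ((veroneseHom ℂ d).comp (spanHom fun i => symCoords n (Y i))) := by
  ext f
  rw [RingHom.mem_ker, AlgHom.comp_apply]
  constructor
  · intro hf
    have hmul : veroneseHom ℂ d (spanHom (fun i => symCoords n (Y i)) f) * h = 0 := by
      refine MvPolynomial.funext fun y => ?_
      rw [map_mul, map_zero, eval_veroneseHom_spanHom]
      by_cases hy : eval y h = 0
      · rw [hy, mul_zero]
      · rw [hf _ (hne y hy) ((hS _ _).mpr ⟨y, hy, rfl⟩), zero_mul]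
    exact (mul_eq_zero.mp hmul).resolve_right h0
  · intro hf X hX hXS
    obtain ⟨y, -, rfl⟩ := (hS X hX).mp hXS
    rw [← eval_veroneseHom_spanHom, hf, map_zero]

/-- The rational normal curve is Zariski closed, because the generators of its ideal cut out
exactly its points. -/
theorem isRationalNormalCurve_zariskiClosure (hd : 0 < d) (hY : LinearIndependent ℂ Y)
    {S : Set (ℙ ℂ (symMatrices n))}
    (hS : vanishingIdealProj S =
      RingHom.ker ((veroneseHom ℂ d).comp (spanHom fun i => symCoords n (Y i)))) :
    IsRationalNormalCurve d (zariskiClosure S) := by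
  classical
  have hv : LinearIndependent ℂ fun i => symCoords n (Y i) :=
    hY.map' _ (LinearMap.ker_eq_bot.mpr (symCoords_injective n))
  have hφ : Function.Injective (Fintype.linearCombination ℂ Y) :=
    hY.fintypeLinearCombination_injective
  refine ⟨hd, Fintype.linearCombination ℂ Y, hφ, Set.ext fun p => ⟨fun hp => ?_, ?_⟩⟩
  · obtain ⟨-, l, u, -, -, -, -, hspan, hker⟩ :=
      exists_generators_ker_veroneseHom_comp_spanHom hd hv
    induction p using Projectivization.ind with
    | h X hX =>
      have hvan : ∀ f ∈ Set.range l ∪ Set.range (hankelMinor u), eval (symCoords n X) f = 0 :=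
        fun f hf => hp f (by rw [hS, hker]; exact Ideal.subset_span hf) X hX rfl
      let x : Fin (d + 1) → ℂ := fun i => eval (symCoords n X) (u i)
      have hX' : X = Fintype.linearCombination ℂ Y x := by
        apply symCoords_injective n
        rw [Fintype.linearCombination_apply, map_sum]
        simp only [map_smul]
        exact hspan _ fun k => hvan _ (Or.inl ⟨k, rfl⟩)
      have hx0 : x ≠ 0 := by
        rintro h
        rw [h, map_zero] at hX'
        exact hX hX'
      have hxm : ∀ q, hankelMinor x q = 0 := fun q => by
        rw [← hvan _ (Or.inr ⟨q, rfl⟩)]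
        exact (map_hankelMinor (eval (symCoords n X)) u q).symm
      obtain ⟨c, s, t, hst, hx⟩ := exists_eq_pow_mul_pow_of_hankelMinor_eq_zero hx0 hxm
      refine ⟨_, ⟨s, t, hst, veronese_ne_zero hst, rfl⟩, ?_⟩
      rw [Projectivization.map_mk, eq_comm, Projectivization.mk_eq_mk_iff']
      refine ⟨c, ?_⟩
      rw [← map_smul, hX']
      congr 1
      ext i
      exact (hx i).symm
  · rintro ⟨_, ⟨s, t, hst, h0, rfl⟩, rfl⟩ f hf X hX hXp
    rw [Projectivization.map_mk, Projectivization.mk_eq_mk_iff'] at hXp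
    obtain ⟨c, rfl⟩ := hXp
    obtain ⟨r, -, hr⟩ := exists_smul_conePoint (Y := Y) hd c s t
    rw [Fintype.linearCombination_apply]
    change evalSym (c • conePoint Y s t) f = 0
    rw [hS, RingHom.mem_ker, AlgHom.comp_apply] at hf
    have := eval_veroneseHom_spanHom (Y := Y) ![r * s, r * t] f
    rw [hf, map_zero] at this
    rw [hr]
    exact this.symm

end Cone

/-! ### The reciprocal curve of a pencil -/

section Pencil

variable {n : ℕ}

/-- The matrices spanning the cone over the reciprocal curve of the pencil spanned by `A` and `B`:
the coefficients of the numerator of the resolvent `B⁻¹ * (t - s * A * B⁻¹)⁻¹` of the pencil. -/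
noncomputable def resolventCoeff (A B : symMatrices n) (i : ℕ) : symMatrices n :=
  ⟨(toMat B)⁻¹ * minpolyQuotient ℂ (toMat A * (toMat B)⁻¹) (i + 1),
    isSymm_inv_mul_aeval A.2 B.2 _⟩

theorem linearIndependent_resolventCoeff (A : symMatrices n) {B : symMatrices n}
    (hB : (toMat B).det ≠ 0) {d : ℕ}
    (hd : (minpoly ℂ (toMat A * (toMat B)⁻¹)).natDegree = d + 1) :
    LinearIndependent ℂ fun i : Fin (d + 1) => resolventCoeff A B i := by
  have hli := linearIndependent_minpolyQuotient
    (Algebra.IsIntegral.isIntegral (R := ℂ) (toMat A * (toMat B)⁻¹)) hd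
  refine LinearIndependent.of_comp
    ((LinearMap.mulLeft ℂ (toMat B)).comp (symMatrices n).subtype) ?_
  have hcomp : ((LinearMap.mulLeft ℂ (toMat B)).comp (symMatrices n).subtype) ∘
      (fun i : Fin (d + 1) => resolventCoeff A B i) =
        fun i : Fin (d + 1) => minpolyQuotient ℂ (toMat A * (toMat B)⁻¹) (i + 1) := by
    ext1 i
    exact Matrix.mul_nonsing_inv_cancel_left (toMat B) _ (isUnit_iff_ne_zero.mpr hB)
  rw [hcomp]
  exact hli

/-- The parametrized matrix inverts `t • B - s • A` up to the scalar `μ(s, t)`. -/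
theorem pencil_mul_conePoint (A : symMatrices n) {B : symMatrices n}
    (hB : (toMat B).det ≠ 0) {d : ℕ}
    (hd : (minpoly ℂ (toMat A * (toMat B)⁻¹)).natDegree = d + 1) (s t : ℂ) :
    (t • toMat B - s • toMat A) *
      toMat (conePoint (fun i : Fin (d + 1) => resolventCoeff A B i) s t) =
        minpolyHomogEval ℂ (toMat A * (toMat B)⁻¹) s t • 1 := by
  rw [← sub_mul_sum_minpolyQuotient
    (Algebra.IsIntegral.isIntegral (R := ℂ) (toMat A * (toMat B)⁻¹)) hd]
  have hB' : toMat B * (toMat B)⁻¹ = 1 := Matrix.mul_nonsing_inv _ (isUnit_iff_ne_zero.mpr hB)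
  have h : toMat (conePoint (fun i : Fin (d + 1) => resolventCoeff A B i) s t) =
      (toMat B)⁻¹ * ∑ i : Fin (d + 1), (s ^ (d - (i : ℕ)) * t ^ (i : ℕ)) •
        minpolyQuotient ℂ (toMat A * (toMat B)⁻¹) (i + 1) := by
    change (symMatrices n).subtype (∑ i : Fin (d + 1), _) = _
    rw [map_sum, Finset.mul_sum]
    refine Finset.sum_congr rfl fun i _ => ?_
    rw [map_smul, Matrix.mul_smul]
    rfl
  rw [h, ← mul_assoc, sub_mul, smul_mul_assoc, smul_mul_assoc, hB']

/-- The polynomial in `(s, t)` with values `minpolyHomogEval`. -/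
noncomputable def minpolyHomog (M : Matrix (Fin n) (Fin n) ℂ) : MvPolynomial (Fin 2) ℂ :=
  ∑ i ∈ Finset.range ((minpoly ℂ M).natDegree + 1),
    C ((minpoly ℂ M).coeff i) * (X 0 ^ ((minpoly ℂ M).natDegree - i) * X 1 ^ i)

theorem eval_minpolyHomog (M : Matrix (Fin n) (Fin n) ℂ) (y : Fin 2 → ℂ) :
    eval y (minpolyHomog M) = minpolyHomogEval ℂ M (y 0) (y 1) := by
  simp [minpolyHomog, minpolyHomogEval]

theorem minpolyHomog_ne_zero (M : Matrix (Fin n) (Fin n) ℂ) : minpolyHomog M ≠ 0 := by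
  intro h
  have h1 := eval_minpolyHomog M ![0, 1]
  rw [h, map_zero, minpolyHomogEval, Finset.sum_range_succ, Finset.sum_eq_zero] at h1
  · rw [(minpoly.monic (Algebra.IsIntegral.isIntegral M)).coeff_natDegree] at h1
    simp at h1
  · intro i hi
    have := Finset.mem_range.mp hi
    have h2 : (minpoly ℂ M).natDegree - i ≠ 0 := by omega
    simp [h2]

/-- The classes of the inverses of the invertible matrices of the pencil are the points of the
rational normal curve at which the homogenized minimal polynomial does not vanish. The scalar
relating two representatives is absorbed into `(s, t)`. -/
theorem mk_mem_inverse_points_iff {L : Submodule ℂ (symMatrices n)} (hn : n ≠ 0)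
    {A B : symMatrices n} (hAB : Submodule.span ℂ {A, B} = L) (hB : (toMat B).det ≠ 0) {d : ℕ}
    (hd0 : 0 < d) (hd : (minpoly ℂ (toMat A * (toMat B)⁻¹)).natDegree = d + 1)
    (X : symMatrices n) (hX : X ≠ 0) :
    Projectivization.mk ℂ X hX ∈ {p : ℙ ℂ (symMatrices n) | ∃ Y ∈ inverseSet L, ∃ hY : Y ≠ 0,
      p = Projectivization.mk ℂ Y hY} ↔
    ∃ y : Fin 2 → ℂ, eval y (minpolyHomog (toMat A * (toMat B)⁻¹)) ≠ 0 ∧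
      X = conePoint (fun i : Fin (d + 1) => resolventCoeff A B i) (y 0) (y 1) := by
  have hres := pencil_mul_conePoint A hB hd
  constructor
  · rintro ⟨Y, ⟨Z, hZ, hZY⟩, hY, hXY⟩
    obtain ⟨c, rfl⟩ := (Projectivization.mk_eq_mk_iff' ℂ X Y hX hY).mp hXY
    rw [← hAB, Submodule.mem_span_pair] at hZ
    obtain ⟨a, b, rfl⟩ := hZ
    have : Nonempty (Fin n) := ⟨⟨0, Nat.pos_of_ne_zero hn⟩⟩
    have hZ : ∀ r : ℂ, (r * b) • toMat B - (r * -a) • toMat A = r • toMat (a • A + b • B) := by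
      intro r
      change _ = r • (a • toMat A + b • toMat B)
      module
    have hYZ := mul_eq_one_comm.mp hZY
    have hP : conePoint (fun i : Fin (d + 1) => resolventCoeff A B i) (-a) b =
        minpolyHomogEval ℂ (toMat A * (toMat B)⁻¹) (-a) b • Y := by
      have h1 := hres (-a) b
      have h2 := hZ 1
      rw [one_mul, one_mul, one_smul] at h2
      rw [h2] at h1
      refine Subtype.ext ?_
      change toMat _ = _ • toMat Y
      have h3 := congrArg (toMat Y * ·) h1
      simpa only [← mul_assoc, hYZ, one_mul, Matrix.mul_smul, mul_one] using h3
    have hab : -a ≠ 0 ∨ b ≠ 0 := by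
      by_contra! h
      obtain rfl : a = 0 := neg_eq_zero.mp h.1
      obtain rfl : b = 0 := h.2
      rw [show toMat ((0 : ℂ) • A + (0 : ℂ) • B) = 0 by simp [toMat], zero_mul] at hZY
      exact zero_ne_one hZY
    -- Otherwise the point with parameters `(-a, b)` would be zero, against independence.
    have hh : minpolyHomogEval ℂ (toMat A * (toMat B)⁻¹) (-a) b ≠ 0 := by
      intro h
      rw [h, zero_smul] at hP
      exact veronese_ne_zero hab (funext
        (Fintype.linearIndependent_iff.mp (linearIndependent_resolventCoeff A hB hd) _ hP))
    obtain ⟨r, hr, hc⟩ := exists_smul_conePoint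
      (Y := fun i : Fin (d + 1) => resolventCoeff A B i) hd0
      (c / minpolyHomogEval ℂ (toMat A * (toMat B)⁻¹) (-a) b) (-a) b
    rw [hP, smul_smul, div_mul_cancel₀ _ hh] at hc
    have hc0 : c ≠ 0 := fun h => hX (by rw [h, zero_smul])
    have hr0 : r ≠ 0 := by
      rintro rfl
      rw [zero_pow hd0.ne'] at hr
      exact div_ne_zero hc0 hh hr.symm
    refine ⟨![r * -a, r * b], ?_, hc⟩
    rw [eval_minpolyHomog]
    change minpolyHomogEval ℂ _ (r * -a) (r * b) ≠ 0
    intro h0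
    have h1 := hres (r * -a) (r * b)
    rw [h0, zero_smul, hZ, ← hc, show toMat (c • Y) = c • toMat Y from rfl, smul_mul_smul_comm,
      hZY] at h1
    exact smul_ne_zero (mul_ne_zero hr0 hc0) one_ne_zero h1
  · rintro ⟨y, hy, rfl⟩
    rw [eval_minpolyHomog] at hy
    set h := minpolyHomogEval ℂ (toMat A * (toMat B)⁻¹) (y 0) (y 1)
    refine ⟨_, ⟨h⁻¹ • (y 1 • B - y 0 • A), ?_, ?_⟩, hX, rfl⟩
    · rw [← hAB]
      refine Submodule.smul_mem _ _ (Submodule.sub_mem _ ?_ ?_) <;>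
        exact Submodule.smul_mem _ _ (Submodule.subset_span (by simp))
    · change (h⁻¹ • (y 1 • toMat B - y 0 • toMat A)) * _ = 1
      rw [smul_mul_assoc, hres, smul_smul, inv_mul_cancel₀ hy, one_smul]

theorem conePoint_resolventCoeff_ne_zero (hn : n ≠ 0) (A : symMatrices n) {B : symMatrices n}
    (hB : (toMat B).det ≠ 0) {d : ℕ}
    (hd : (minpoly ℂ (toMat A * (toMat B)⁻¹)).natDegree = d + 1) (y : Fin 2 → ℂ)
    (hy : eval y (minpolyHomog (toMat A * (toMat B)⁻¹)) ≠ 0) :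
    conePoint (fun i : Fin (d + 1) => resolventCoeff A B i) (y 0) (y 1) ≠ 0 := by
  intro h
  have hres := pencil_mul_conePoint A hB hd (y 0) (y 1)
  have : Nonempty (Fin n) := ⟨⟨0, Nat.pos_of_ne_zero hn⟩⟩
  rw [eval_minpolyHomog] at hy
  rw [h, show toMat (0 : symMatrices n) = 0 from rfl, mul_zero] at hres
  exact smul_ne_zero hy one_ne_zero hres.symm

end Pencil

theorem mainTheorem1 (n : ℕ) (L : Submodule ℂ (symMatrices n)) (hL : IsRegularPencil L)
    (σ : Multiset (Multiset ℕ)) (hσ : IsSegreSymbol L σ)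
    (d : ℕ) (hd : d = sumFirstParts σ - 1) :
    IsRationalNormalCurve d (reciprocalCurve L) ∧
    (vanishingIdealProj (reciprocalCurve L)).IsPrime ∧
    d + 1 ≤ (n + 1).choose 2 ∧
    ∃ (l : Fin ((n + 1).choose 2 - d - 1) → MvPolynomial (SymIndex n) ℂ)
      (u : Fin (d + 1) → MvPolynomial (SymIndex n) ℂ),
      (∀ k, (l k).IsHomogeneous 1) ∧ (∀ i, (u i).IsHomogeneous 1) ∧
      LinearIndependent ℂ (Sum.elim l u) ∧
      LinearIndependent ℂ (hankelMinor u) ∧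
      (Set.range (hankelMinor u)).ncard = d.choose 2 ∧
      vanishingIdealProj (reciprocalCurve L) =
        Ideal.span (Set.range l ∪ Set.range (hankelMinor u)) := by
  obtain ⟨A, B, hAB, hspan, hB, s, α, e, hJ, rfl⟩ := hσ
  rw [sumFirstParts_eq_natDegree_minpoly hJ] at hd
  set M := toMat A * (toMat B)⁻¹ with hM
  have hn : n ≠ 0 := by
    rintro rfl
    exact hAB.ne_zero 0 (Subtype.ext (Subsingleton.elim _ _))
  have : Nonempty (Fin n) := ⟨⟨0, Nat.pos_of_ne_zero hn⟩⟩
  -- `A` is not a multiple of `B`, so `M` is not scalar.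
  have h2 : 2 ≤ (minpoly ℂ M).natDegree := by
    rw [minpoly.two_le_natDegree_iff (Algebra.IsIntegral.isIntegral M)]
    rintro ⟨a, ha⟩
    have hA : toMat A = a • toMat B := by
      rw [← Matrix.nonsing_inv_mul_cancel_right (toMat B) (toMat A) (isUnit_iff_ne_zero.mpr hB),
        ← hM, ← ha, ← Algebra.smul_def]
    have h0 : (1 : ℂ) • A + (-a) • B = 0 := by
      rw [show A = a • B from Subtype.ext hA]
      module
    exact one_ne_zero (LinearIndependent.pair_iff.mp hAB 1 (-a) h0).1
  have hdeg : (minpoly ℂ M).natDegree = d + 1 := by omega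
  have hd0 : 0 < d := by omega
  have hY := linearIndependent_resolventCoeff A hB hdeg
  have hker := vanishingIdealProj_eq_ker (minpolyHomog_ne_zero M)
    (conePoint_resolventCoeff_ne_zero hn A hB hdeg)
    (mk_mem_inverse_points_iff hn hspan hB hd0 hdeg)
  have hv := hY.map' _ (LinearMap.ker_eq_bot.mpr (symCoords_injective n))
  have hgen := exists_generators_ker_veroneseHom_comp_spanHom hd0 hv
  rw [card_symIndex] at hgen
  obtain ⟨hle, l, u, hl, hu, hlu, hmin, -, hI⟩ := hgen
  have hcurve : vanishingIdealProj (reciprocalCurve L) = _ :=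
    (vanishingIdealProj_zariskiClosure _).trans hker
  refine ⟨isRationalNormalCurve_zariskiClosure hd0 hY hker, ?_, hle, l, u, hl, hu, hlu, hmin,
    ?_, ?_⟩
  · rw [hcurve]
    exact RingHom.ker_isPrime _
  · rw [Set.ncard_eq_toFinset_card', Set.toFinset_range,
      Finset.card_image_of_injective _ hmin.injective, Finset.card_univ, card_columnPairs]
  · rw [hcurve]
    exact hI
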